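/- Let $\mathbb C$ be a category with finite products and let $\Sigma:\mathbb C\to\mathbb C$ be a functor such that every object $X$ generates a free $\Sigma$-algebra, i.e. the forgetful functor from $\Sigma$-algebras to $\mathbb C$ has a left adjoint. Let $(\Sigma^{*},\eta^{\Sigma},\mu^{\Sigma})$ be the induced free monad, and for a $\Sigma$-algebra $g:\Sigma X\to X$ let $g^{\#}:\Sigma^{*}X\to X$ be the induced Eilenberg–Moore algebra. Let $(T,\eta,\mu)$ be a monad on $\mathbb C$ whose Kleisli category $\mathcal{K}\ell(T)$, with composition $\diamond$, is $\omega\mathrm{Cpo}^{\vee}$-enriched: every hom-set is partially ordered with all finite joins and with suprema of ascending $\omega$-chains, $i\diamond(f\vee f')=(i\diamond f)\vee(i\diamond f')$, and $k\diamond\bigvee_n f_n=\bigvee_n (k\diamond f_n)$, $(\bigvee_n k_n)\diamond f=\bigvee_n (k_n\diamond f)$ for ascending $\omega$-chains. Assume moreover that joins are stable under precomposition with morphisms of $\mathbb C$: $(f\vee f')\circ p=(f\circ p)\vee(f'\circ p)$ for all $p:W\to X$ in $\mathbb C$ and $f,f':X\to TY$. For $\alpha:X\to TX$ let $\alpha^{*}:X\to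 TX$ be the least $\beta\ge\alpha$ with $\eta_X\le\beta$ and $\beta\diamond\beta\le\beta$; explicitly, $\alpha^{*}=\bigvee_{n<\omega}(\eta_X\vee\alpha)^{n}$ with powers taken in $\mathcal{K}\ell(T)$. Let $\lambda:\Sigma^{*}(\mathrm{Id}\times T)\Rightarrow T\Sigma^{*}$ be a GSOS law, i.e. a natural transformation such that $$\lambda\circ\mu^{\Sigma}_{\mathrm{Id}\times T}=T\mu^{\Sigma}\circ\lambda_{\Sigma^{*}}\circ\Sigma^{*}\langle\Sigma^{*}\pi_1,\lambda\rangle,\qquad \lambda\circ\eta^{\Sigma}_{\mathrm{Id}\times T}=T\eta^{\Sigma}\circ\pi_2 .$$ Suppose that for every object $X$, every $f:X\to TX$ and every ascending $\omega$-chain $f_0\le f_1\le\cdots:X\to TX$: 1. (Continuity) $\lambda_X\circ\Sigma^{*}\langle \mathrm{id},\bigvee_i f_i\rangle=\bigvee_i\,\lambda_X\circ\Sigma^{*}\langle \mathrm{id},f_i\rangle$ (the right-hand supremum existing); 2. (Unitality) $\lambda_X\circ\Sigma^{*}\langle \mathrm{id},\eta_X\vee f\rangle\le(\lambda_X\circ\Sigma^{*}\langle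 \mathrm{id},f\rangle)^{*}$; 3. (Observability) $\lambda_X\circ\Sigma^{*}\langle \mathrm{id},f\diamond f\rangle\le(\lambda_X\circ\Sigma^{*}\langle \mathrm{id},f\rangle)^{*}$. Let $a:\Sigma A\to A$ be an initial $\Sigma$-algebra and $z:Z\to TZ$ a final $T$-coalgebra. A $\lambda$-bialgebra is a pair $g':\Sigma X\to X$, $k:X\to TX$ with $k\circ g'^{\#}=Tg'^{\#}\circ\lambda_X\circ\Sigma^{*}\langle\mathrm{id},k\rangle$. Let $h:A\to TA$ and $g:\Sigma Z\to Z$ be the morphisms for which $(a,h)$ and $(g,z)$ are $\lambda$-bialgebras (the initial and the final one). For a coalgebra $k:X\to TX$ let $k^{\dagger}:X\to Z$ be the unique $T$-coalgebra homomorphism from $k^{*}$ to $z$. Then $h^{\dagger}:A\to Z$ is a $\Sigma$-algebra homomorphism from $a$ to $z^{\dagger}\circ g:\Sigma Z\to Z$, that is, $$h^{\dagger}\circ a=z^{\dagger}\circ g\circ\Sigma h^{\dagger}.$$ -/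

import Mathlib

open CategoryTheory CategoryTheory.Limits

universe v u

namespace WeakGSOS

/-! ### Order enrichment -/

/-- A category is `ωCPO`-with-joins enriched: every hom-set is a partial order with all finite
joins (binary joins and a least element) and suprema of ascending `ω`-chains, postcomposition
preserves binary joins, and composition is continuous in both arguments. The equations
`g ∘ ⋁ fᵢ = ⋁ (g ∘ fᵢ)` and `(⋁ gᵢ) ∘ f = ⋁ (gᵢ ∘ f)` say that the left-hand side is the least
upper bound of the family on the right. -/
class OmegaCpoJoinEnriched (K : Type u) [Category.{v} K] where
  homOrder : ∀ X Y : K, SemilatticeSup (X ⟶ Y)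
  exists_bot : ∀ X Y : K, ∃ b : X ⟶ Y, ∀ f : X ⟶ Y, b ≤ f
  comp_join : ∀ {X Y Z : K} (f g : X ⟶ Y) (i : Y ⟶ Z), (f ⊔ g) ≫ i = (f ≫ i) ⊔ (g ≫ i)
  chainSup : ∀ {X Y : K}, (ℕ →o (X ⟶ Y)) → (X ⟶ Y)
  isLUB_chainSup : ∀ {X Y : K} (f : ℕ →o (X ⟶ Y)), IsLUB (Set.range f) (chainSup f)
  chainSup_comp : ∀ {X Y Z : K} (f : ℕ →o (X ⟶ Y)) (g : Y ⟶ Z),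
    IsLUB (Set.range fun n => f n ≫ g) (chainSup f ≫ g)
  comp_chainSup : ∀ {X Y Z : K} (f : X ⟶ Y) (g : ℕ →o (Y ⟶ Z)),
    IsLUB (Set.range fun n => f ≫ g n) (f ≫ chainSup g)

attribute [instance, reducible] OmegaCpoJoinEnriched.homOrder

section Closure

variable {K : Type u} [Category.{v} K] [OmegaCpoJoinEnriched K]

/-- The chain `f ≤ g ≤ g ≤ ⋯`. -/
def pairChain {X Y : K} {f g : X ⟶ Y} (h : f ≤ g) : ℕ →o (X ⟶ Y) where
  toFun n := if n = 0 then f else g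
  monotone' := by
    intro m n hmn
    by_cases hm : m = 0
    · by_cases hn : n = 0
      · simp [hm, hn]
      · simpa [hm, hn] using h
    · have hn : n ≠ 0 := by omega
      simp [hm, hn]

theorem pairChain_apply {X Y : K} {f g : X ⟶ Y} (h : f ≤ g) (n : ℕ) :
    pairChain h n = if n = 0 then f else g := rfl

theorem chainSup_pairChain {X Y : K} {f g : X ⟶ Y} (h : f ≤ g) :
    OmegaCpoJoinEnriched.chainSup (pairChain h) = g := by
  refine (OmegaCpoJoinEnriched.isLUB_chainSup (pairChain h)).unique ⟨?_, ?_⟩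
  · rintro _ ⟨n, rfl⟩
    rw [pairChain_apply]
    split_ifs
    · exact h
    · exact le_refl g
  · intro b hb
    exact hb ⟨1, rfl⟩

theorem comp_mono {X Y Z : K} {f f' : X ⟶ Y} {g g' : Y ⟶ Z} (hf : f ≤ f') (hg : g ≤ g') :
    f ≫ g ≤ f' ≫ g' := by
  have h1 : f ≫ g ≤ f' ≫ g := by
    have := (OmegaCpoJoinEnriched.chainSup_comp (pairChain hf) g).1 ⟨0, rfl⟩
    rwa [chainSup_pairChain] at this
  have h2 : f' ≫ g ≤ f' ≫ g' := by
    have := (OmegaCpoJoinEnriched.comp_chainSup f' (pairChain hg)).1 ⟨0, rfl⟩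
    rwa [chainSup_pairChain] at this
  exact h1.trans h2

/-- The power `(id ∨ α)ⁿ`, with `(id ∨ α)ⁿ⁺¹ = (id ∨ α)ⁿ ∘ (id ∨ α)`. -/
def reflPow {X : K} (α : X ⟶ X) : ℕ → (X ⟶ X)
  | 0 => 𝟙 X
  | n + 1 => (𝟙 X ⊔ α) ≫ reflPow α n

/-- The ascending chain of the powers `(id ∨ α)ⁿ`. -/
def reflPowChain {X : K} (α : X ⟶ X) : ℕ →o (X ⟶ X) where
  toFun := reflPow α
  monotone' := monotone_nat_of_le_succ fun n => by
    have := comp_mono (le_sup_left : 𝟙 X ≤ 𝟙 X ⊔ α) (le_refl (reflPow α n))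
    rwa [Category.id_comp] at this

/-- The reflexive transitive closure (free monad) `α* = ⋁ₙ (id ∨ α)ⁿ` of an endomorphism. -/
def rtClosure {X : K} (α : X ⟶ X) : X ⟶ X :=
  OmegaCpoJoinEnriched.chainSup (reflPowChain α)

/-- Monads on an object of an order-enriched category, i.e. closure operators. -/
def IsClosureOp {X : K} (ε : X ⟶ X) : Prop :=
  𝟙 X ≤ ε ∧ ε ≫ ε ≤ ε

/-- `β` is the free monad over `α`: the least closure operator above `α`. -/
def IsFreeMonadOver {X : K} (α β : X ⟶ X) : Prop :=
  IsClosureOp β ∧ α ≤ β ∧ ∀ γ : X ⟶ X, IsClosureOp γ → α ≤ γ → β ≤ γ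

theorem reflPow_add {X : K} (α : X ⟶ X) (m n : ℕ) :
    reflPow α m ≫ reflPow α n = reflPow α (m + n) := by
  induction m with
  | zero => simp [reflPow]
  | succ m ih => rw [Nat.succ_add]; simp [reflPow, ih]

/-- The explicit formula for `α*` indeed yields the free monad over `α`. -/
theorem rtClosure_isFreeMonadOver {X : K} (α : X ⟶ X) : IsFreeMonadOver α (rtClosure α) := by
  have lub := OmegaCpoJoinEnriched.isLUB_chainSup (reflPowChain α)
  have up : ∀ n, reflPow α n ≤ rtClosure α := fun n => lub.1 ⟨n, rfl⟩
  refine ⟨⟨up 0, ?_⟩, ?_, ?_⟩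
  · refine (OmegaCpoJoinEnriched.chainSup_comp (reflPowChain α) (rtClosure α)).2 ?_
    rintro _ ⟨m, rfl⟩
    refine (OmegaCpoJoinEnriched.comp_chainSup (reflPow α m) (reflPowChain α)).2 ?_
    rintro _ ⟨n, rfl⟩
    exact (reflPow_add α m n).le.trans (up _)
  · refine le_trans ?_ (up 1)
    simp [reflPow]
  · intro γ hγ hα
    refine lub.2 ?_
    rintro _ ⟨n, rfl⟩
    change reflPow α n ≤ γ
    induction n with
    | zero => exact hγ.1
    | succ n ih => exact (comp_mono (sup_le hγ.1 hα) ih).trans hγ.2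

end Closure

/-! ### Free algebras and GSOS laws -/

section Laws

variable {C : Type u} [Category.{v} C]

/-- The free monad `Σ*` over an endofunctor `S = Σ`: the monad induced by an adjunction between
the forgetful functor from `Σ`-algebras and a free `Σ`-algebra functor `F`. -/
abbrev freeMonad {S : C ⥤ C} {F : C ⥤ Endofunctor.Algebra S}
    (adj : F ⊣ Endofunctor.Algebra.forget S) : Monad C :=
  adj.toMonad

/-- The Eilenberg-Moore algebra `g^# : Σ* X ⟶ X` induced by a `Σ`-algebra `g : Σ X ⟶ X`. -/
def emAlgebra {S : C ⥤ C} {F : C ⥤ Endofunctor.Algebra S}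
    (adj : F ⊣ Endofunctor.Algebra.forget S) {X : C} (g : S.obj X ⟶ X) :
    (freeMonad adj).obj X ⟶ X :=
  (adj.counit.app (Endofunctor.Algebra.mk X g)).f

variable [HasFiniteProducts C]

/-- A GSOS law of `S = Σ` over `B`: a natural transformation `λ : Σ*(Id × B) ⟶ BΣ*` respecting
the multiplication and the unit of the free monad `Σ*`. -/
structure GSOSLaw {S : C ⥤ C} {F : C ⥤ Endofunctor.Algebra S}
    (adj : F ⊣ Endofunctor.Algebra.forget S) (B : C ⥤ C) where
  app : ∀ X : C, (freeMonad adj).obj (X ⨯ B.obj X) ⟶ B.obj ((freeMonad adj).obj X)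
  naturality : ∀ {X Y : C} (p : X ⟶ Y),
    (freeMonad adj).map (prod.map p (B.map p)) ≫ app Y =
      app X ≫ B.map ((freeMonad adj).map p)
  mul_law : ∀ X : C,
    (freeMonad adj).μ.app (X ⨯ B.obj X) ≫ app X =
      (freeMonad adj).map (prod.lift ((freeMonad adj).map prod.fst) (app X)) ≫
        app ((freeMonad adj).obj X) ≫ B.map ((freeMonad adj).μ.app X)
  unit_law : ∀ X : C,
    (freeMonad adj).η.app (X ⨯ B.obj X) ≫ app X =
      prod.snd ≫ B.map ((freeMonad adj).η.app X)

namespace GSOSLaw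

variable {S : C ⥤ C} {F : C ⥤ Endofunctor.Algebra S}
  {adj : F ⊣ Endofunctor.Algebra.forget S}

/-- The `B`-coalgebra `λ_X ∘ Σ*⟨id, f⟩ : Σ* X ⟶ B Σ* X` for a `B`-coalgebra `f : X ⟶ B X`. -/
noncomputable def extend {B : C ⥤ C} (lam : GSOSLaw adj B) {X : C} (f : X ⟶ B.obj X) :
    (freeMonad adj).obj X ⟶ B.obj ((freeMonad adj).obj X) :=
  (freeMonad adj).map (prod.lift (𝟙 X) f) ≫ lam.app X

/-- `Σ X --g--> X --h--> B X` is a bialgebra for the GSOS law. -/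
def IsBialgebra {B : C ⥤ C} (lam : GSOSLaw adj B) {X : C}
    (g : S.obj X ⟶ X) (h : X ⟶ B.obj X) : Prop :=
  emAlgebra adj g ≫ h = lam.extend h ≫ B.map (emAlgebra adj g)

end GSOSLaw

/-! ### Monads with order-enriched Kleisli category -/

/-- A morphism `X ⟶ T Y`, viewed as a morphism `X ⟶ Y` of the Kleisli category. -/
def toKl {T : Monad C} {X Y : C} (f : X ⟶ T.obj Y) : Kleisli.mk T X ⟶ Kleisli.mk T Y :=
  Kleisli.Hom.mk f

/-- Binary joins of Kleisli morphisms are stable under precomposition with morphisms of the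
base category: `(f ∨ g) ∘ p = (f ∘ p) ∨ (g ∘ p)` for `p : W ⟶ X` and `f, g : X ⟶ T Y`. -/
def JoinsStableUnderBase (T : Monad C) [OmegaCpoJoinEnriched (Kleisli T)] : Prop :=
  ∀ {W X Y : C} (p : W ⟶ X) (f g : Kleisli.mk T X ⟶ Kleisli.mk T Y),
    toKl (p ≫ (f ⊔ g).of) = toKl (p ≫ f.of) ⊔ toKl (p ≫ g.of)

/-- The reflexive transitive closure `h* : X ⟶ T X` of a `T`-coalgebra `h`, taken in the Kleisli
category of `T`. -/
def saturate {T : Monad C} [OmegaCpoJoinEnriched (Kleisli T)] {X : C} (h : X ⟶ T.obj X) :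
    X ⟶ T.obj X :=
  (rtClosure (toKl h)).of

/-- `h^† : X ⟶ Z`, the unique coalgebra homomorphism from the saturated coalgebra `h*` to the
final `T`-coalgebra. -/
def weakBehaviour {T : Monad C} [OmegaCpoJoinEnriched (Kleisli T)]
    {Z : Endofunctor.Coalgebra T.toFunctor} (hZ : IsTerminal Z) {X : C} (h : X ⟶ T.obj X) :
    X ⟶ Z.V :=
  (hZ.from (Endofunctor.Coalgebra.mk X (saturate h))).f

namespace GSOSLaw

variable {S : C ⥤ C} {F : C ⥤ Endofunctor.Algebra S}
  {adj : F ⊣ Endofunctor.Algebra.forget S} {T : Monad C}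

/-- The assignment `f ↦ λ_X ∘ Σ*⟨id, f⟩` on endomorphisms of the Kleisli category of `T`. -/
noncomputable def klExtend (lam : GSOSLaw adj T.toFunctor) {X : C}
    (f : Kleisli.mk T X ⟶ Kleisli.mk T X) :
    Kleisli.mk T ((freeMonad adj).obj X) ⟶ Kleisli.mk T ((freeMonad adj).obj X) :=
  toKl (lam.extend f.of)

variable [OmegaCpoJoinEnriched (Kleisli T)]

/-- Continuity: `λ ∘ Σ*⟨id, ⋁ᵢ fᵢ⟩ = ⋁ᵢ λ ∘ Σ*⟨id, fᵢ⟩` for ascending chains `f₀ ≤ f₁ ≤ ⋯`. -/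
def Continuity (lam : GSOSLaw adj T.toFunctor) : Prop :=
  ∀ (X : C) (f : ℕ →o (Kleisli.mk T X ⟶ Kleisli.mk T X)),
    IsLUB (Set.range fun n => lam.klExtend (f n))
      (lam.klExtend (OmegaCpoJoinEnriched.chainSup f))

/-- Unitality: `λ ∘ Σ*⟨id, η ∨ f⟩ ≤ (λ ∘ Σ*⟨id, f⟩)*`. -/
def Unitality (lam : GSOSLaw adj T.toFunctor) : Prop :=
  ∀ (X : C) (f : Kleisli.mk T X ⟶ Kleisli.mk T X),
    lam.klExtend (𝟙 (Kleisli.mk T X) ⊔ f) ≤ rtClosure (lam.klExtend f)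

/-- Observability: `λ ∘ Σ*⟨id, f ⋄ f⟩ ≤ (λ ∘ Σ*⟨id, f⟩)*`, where `⋄` is Kleisli composition. -/
def Observability (lam : GSOSLaw adj T.toFunctor) : Prop :=
  ∀ (X : C) (f : Kleisli.mk T X ⟶ Kleisli.mk T X),
    lam.klExtend (f ≫ f) ≤ rtClosure (lam.klExtend f)

end GSOSLaw

end Laws

end WeakGSOS

namespace WeakGSOS

/-! ### Closures of endomorphisms in an order-enriched category. -/

section Order

variable {K : Type u} [Category.{v} K] [OmegaCpoJoinEnriched K] {X Y : K}

/-! Every identity comes from uniqueness of homomorphisms into the final coalgebra `z`. Let `u : A ⟶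
Z` be the homomorphism from `h` to `z`. By the bialgebra laws, finality makes `u` a `Σ`-algebra
homomorphism. Saturation preserves homomorphisms (`saturate_hom`), so `h† = z† ∘ u`. It remains to
show `z† ∘ g ∘ Σz† = z† ∘ g`.

Write `ext k = λ ∘ Σ*⟨id, k⟩`. Then `z† ∘ g^#` is a homomorphism `(ext z)* ⟶ z`, while `Σ*z†` is one
from `(ext z*)*` to `(ext z)*`. The three conditions on `λ` give `(ext z*)* = (ext z)*`
(`rtClosure_klExtend_rtClosure`), so finality yields the equation for `Σ*`; restriction to `Σ`
finishes. -/

theorem reflPow_le_rtClosure (α : X ⟶ X) (n : ℕ) : reflPow α n ≤ rtClosure α :=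
  (OmegaCpoJoinEnriched.isLUB_chainSup (reflPowChain α)).1 ⟨n, rfl⟩

theorem isClosureOp_rtClosure (α : X ⟶ X) : IsClosureOp (rtClosure α) :=
  (rtClosure_isFreeMonadOver α).1

theorem le_rtClosure (α : X ⟶ X) : α ≤ rtClosure α :=
  (rtClosure_isFreeMonadOver α).2.1

theorem rtClosure_le_of_le_rtClosure {α β : X ⟶ X} (h : α ≤ rtClosure β) :
    rtClosure α ≤ rtClosure β :=
  (rtClosure_isFreeMonadOver α).2.2 _ (isClosureOp_rtClosure β) h

/-- A morphism intertwining the powers of two endomorphisms intertwines their closures. -/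
theorem comp_rtClosure_of_comp_reflPow {p : X ⟶ Y} {α : X ⟶ X} {β : Y ⟶ Y}
    (h : p ≫ (𝟙 Y ⊔ β) = (𝟙 X ⊔ α) ≫ p) :
    p ≫ rtClosure β = rtClosure α ≫ p := by
  have hpow : ∀ n, p ≫ reflPow β n = reflPow α n ≫ p := by
    intro n
    induction n with
    | zero => simp [reflPow]
    | succ n ih =>
      simp only [reflPow, Category.assoc]
      rw [← ih, ← Category.assoc, h, Category.assoc]
  refine (OmegaCpoJoinEnriched.comp_chainSup p (reflPowChain β)).unique ?_
  have hr : (fun n => p ≫ reflPowChain β n) = fun n => reflPowChain α n ≫ p := funext hpow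
  rw [hr]
  exact OmegaCpoJoinEnriched.chainSup_comp (reflPowChain α) p

/-- The chain of iterated squares `(id ∨ α)^(2ⁿ)`. -/
def reflSquareChain (α : X ⟶ X) : ℕ →o (X ⟶ X) where
  toFun n := reflPow α (2 ^ n)
  monotone' _ _ hmn := (reflPowChain α).monotone (Nat.pow_le_pow_right two_pos hmn)

/-- The powers `2ⁿ` are cofinal among all exponents. They are used because observability controls
only squares `f ⋄ f`. -/
theorem chainSup_reflSquareChain (α : X ⟶ X) :
    OmegaCpoJoinEnriched.chainSup (reflSquareChain α) = rtClosure α := by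
  have lub := OmegaCpoJoinEnriched.isLUB_chainSup (reflSquareChain α)
  refine lub.unique ⟨?_, fun b hb => ?_⟩
  · rintro _ ⟨n, rfl⟩
    exact reflPow_le_rtClosure α _
  · refine (OmegaCpoJoinEnriched.isLUB_chainSup (reflPowChain α)).2 ?_
    rintro _ ⟨n, rfl⟩
    exact ((reflPowChain α).monotone (Nat.lt_two_pow_self (n := n)).le).trans (hb ⟨n, rfl⟩)

end Order

/-! ### Passing from `Σ*` back to `Σ`. -/

section FreeAlgebra

variable {C : Type u} [Category.{v} C] {S : C ⥤ C} {F : C ⥤ Endofunctor.Algebra S}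
  (adj : F ⊣ Endofunctor.Algebra.forget S)

/-- The insertion of generators into the carrier of the free algebra. -/
def generators (X : C) : X ⟶ (F.obj X).a :=
  adj.unit.app X

/-- The inclusion `Σ X ⟶ Σ* X` of operations applied to generators. -/
def opInclusion (X : C) : S.obj X ⟶ (freeMonad adj).obj X :=
  S.map (generators adj X) ≫ (F.obj X).str

theorem opInclusion_naturality {X Y : C} (p : X ⟶ Y) :
    opInclusion adj X ≫ (freeMonad adj).map p = S.map p ≫ opInclusion adj Y := by
  have h1 : S.map (F.map p).f ≫ (F.obj Y).str = (F.obj X).str ≫ (F.map p).f := (F.map p).h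
  have h2 : p ≫ generators adj Y = generators adj X ≫ (F.map p).f := adj.unit.naturality p
  have h3 : (S.map (generators adj X) ≫ (F.obj X).str) ≫ (F.map p).f =
      S.map p ≫ S.map (generators adj Y) ≫ (F.obj Y).str := by
    rw [Category.assoc, ← h1, ← S.map_comp_assoc, ← S.map_comp_assoc, h2]
  exact h3

/-- The counit is an algebra homomorphism, and a triangle identity makes it a retraction of the
generators. -/
theorem opInclusion_emAlgebra {X : C} (g : S.obj X ⟶ X) :
    opInclusion adj X ≫ emAlgebra adj g = g := by
  let c : (F.obj X).a ⟶ X := emAlgebra adj g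
  have h1 : S.map c ≫ g = (F.obj X).str ≫ c := (adj.counit.app (Endofunctor.Algebra.mk X g)).h
  have h2 : generators adj X ≫ c = 𝟙 X :=
    adj.right_triangle_components (Endofunctor.Algebra.mk X g)
  have h3 : (S.map (generators adj X) ≫ (F.obj X).str) ≫ c = g := by
    rw [Category.assoc, ← h1, ← S.map_comp_assoc, h2, S.map_id, Category.id_comp]
  exact h3

end FreeAlgebra

/-! ### Coalgebra homomorphisms as pure Kleisli morphisms. -/

section KleisliCoalgebra

variable {C : Type u} [Category.{v} C] {T : Monad C}

/-- A morphism of the base category, viewed as a pure Kleisli morphism. -/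
def pureKl (T : Monad C) {X Y : C} (p : X ⟶ Y) : Kleisli.mk T X ⟶ Kleisli.mk T Y :=
  toKl (p ≫ T.η.app Y)

theorem pureKl_comp {W X Y : C} (p : W ⟶ X) (f : Kleisli.mk T X ⟶ Kleisli.mk T Y) :
    pureKl T p ≫ f = toKl (p ≫ f.of) := by
  apply Kleisli.Hom.ext
  change (p ≫ T.η.app X) ≫ T.map f.of ≫ T.μ.app Y = p ≫ f.of
  have h : f.of ≫ T.η.app (T.obj Y) = T.η.app X ≫ T.map f.of := T.η.naturality f.of
  rw [Category.assoc, ← reassoc_of% h, T.left_unit]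
  exact congrArg (p ≫ ·) (Category.comp_id f.of)

theorem comp_pureKl {W X Y : C} (f : Kleisli.mk T W ⟶ Kleisli.mk T X) (p : X ⟶ Y) :
    f ≫ pureKl T p = toKl (f.of ≫ T.map p) := by
  apply Kleisli.Hom.ext
  change f.of ≫ T.map (p ≫ T.η.app Y) ≫ T.μ.app Y = f.of ≫ T.map p
  rw [T.map_comp, Category.assoc, T.right_unit]
  exact congrArg (f.of ≫ ·) (Category.comp_id (T.map p))

theorem toKl_injective {X Y : C} {f g : X ⟶ T.obj Y} (h : toKl f = toKl g) : f = g :=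
  congrArg Kleisli.Hom.of h

/-- Coalgebra homomorphisms from `k` to `k'` are homomorphisms from `k*` to `k'*`. -/
theorem saturate_hom [OmegaCpoJoinEnriched (Kleisli T)] (hT : JoinsStableUnderBase T)
    {X Y : C} {k : X ⟶ T.obj X} {k' : Y ⟶ T.obj Y} {p : X ⟶ Y}
    (hp : k ≫ T.map p = p ≫ k') :
    saturate k ≫ T.map p = p ≫ saturate k' := by
  have hstep : pureKl T p ≫ (𝟙 (Kleisli.mk T Y) ⊔ toKl k') =
      (𝟙 (Kleisli.mk T X) ⊔ toKl k) ≫ pureKl T p := by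
    have hk : pureKl T p ≫ toKl k' = toKl k ≫ pureKl T p := by
      rw [pureKl_comp, comp_pureKl]
      exact congrArg toKl hp.symm
    -- The enrichment distributes joins only over postcomposition; on the other side `hT` does so,
    -- because `p` is pure.
    rw [pureKl_comp, hT, ← pureKl_comp, ← pureKl_comp, hk,
      OmegaCpoJoinEnriched.comp_join, Category.comp_id, Category.id_comp]
  have := comp_rtClosure_of_comp_reflPow hstep
  rw [pureKl_comp, comp_pureKl] at this
  exact (toKl_injective this).symm

theorem terminal_hom_unique {Z : Endofunctor.Coalgebra T.toFunctor} (hZ : IsTerminal Z) {X : C}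
    {k : X ⟶ T.obj X} {p q : X ⟶ Z.V} (hp : k ≫ T.map p = p ≫ Z.str)
    (hq : k ≫ T.map q = q ≫ Z.str) : p = q :=
  congrArg Endofunctor.Coalgebra.Hom.f (hZ.hom_ext
    (⟨p, hp⟩ : Endofunctor.Coalgebra.mk X k ⟶ Z) (⟨q, hq⟩ : Endofunctor.Coalgebra.mk X k ⟶ Z))

theorem hom_comp {X Y W : C} {k : X ⟶ T.obj X} {l : Y ⟶ T.obj Y} {m : W ⟶ T.obj W}
    {p : X ⟶ Y} {q : Y ⟶ W} (hp : k ≫ T.map p = p ≫ l) (hq : l ≫ T.map q = q ≫ m) :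
    k ≫ T.map (p ≫ q) = (p ≫ q) ≫ m := by
  rw [T.map_comp, reassoc_of% hp, hq, Category.assoc]

theorem weakBehaviour_hom [OmegaCpoJoinEnriched (Kleisli T)]
    {Z : Endofunctor.Coalgebra T.toFunctor} (hZ : IsTerminal Z) {X : C} (k : X ⟶ T.obj X) :
    saturate k ≫ T.map (weakBehaviour hZ k) = weakBehaviour hZ k ≫ Z.str :=
  (hZ.from (Endofunctor.Coalgebra.mk X (saturate k))).h

end KleisliCoalgebra

/-! ### Saturation and the GSOS law. -/

namespace GSOSLaw

variable {C : Type u} [Category.{v} C] [HasFiniteProducts C] {S : C ⥤ C}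
  {F : C ⥤ Endofunctor.Algebra S} {adj : F ⊣ Endofunctor.Algebra.forget S} {T : Monad C}

theorem extend_hom (lam : GSOSLaw adj T.toFunctor) {X Y : C}
    {k : X ⟶ T.obj X} {k' : Y ⟶ T.obj Y} {p : X ⟶ Y} (hp : k ≫ T.map p = p ≫ k') :
    lam.extend k ≫ T.map ((freeMonad adj).map p) = (freeMonad adj).map p ≫ lam.extend k' := by
  unfold extend
  rw [Category.assoc, ← lam.naturality p, ← Functor.map_comp_assoc, ← Functor.map_comp_assoc]
  congr 2
  ext <;> simp [hp]

variable [OmegaCpoJoinEnriched (Kleisli T)] {lam : GSOSLaw adj T.toFunctor}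

theorem Continuity.klExtend_mono (hcont : lam.Continuity) {X : C}
    {f f' : Kleisli.mk T X ⟶ Kleisli.mk T X} (hf : f ≤ f') :
    lam.klExtend f ≤ lam.klExtend f' := by
  have := (hcont X (pairChain hf)).1 ⟨0, rfl⟩
  rwa [chainSup_pairChain] at this

/-- Continuity reduces the nontrivial inequality to the powers `(id ∨ f)^(2ⁿ)`; unitality is the
base case and observability the doubling step. -/
theorem rtClosure_klExtend_rtClosure (hcont : lam.Continuity) (hunit : lam.Unitality)
    (hobs : lam.Observability) {X : C} (f : Kleisli.mk T X ⟶ Kleisli.mk T X) :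
    rtClosure (lam.klExtend (rtClosure f)) = rtClosure (lam.klExtend f) := by
  refine le_antisymm (rtClosure_le_of_le_rtClosure ?_) (rtClosure_le_of_le_rtClosure
    ((hcont.klExtend_mono (le_rtClosure f)).trans (le_rtClosure _)))
  rw [← chainSup_reflSquareChain f]
  refine (hcont X (reflSquareChain f)).2 ?_
  rintro _ ⟨n, rfl⟩
  change lam.klExtend (reflPow f (2 ^ n)) ≤ _
  induction n with
  | zero =>
    have h1 : reflPow f (2 ^ 0) = 𝟙 _ ⊔ f := by simp [reflPow]
    rw [h1]
    exact hunit X f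
  | succ n ih =>
    rw [pow_succ, mul_two, ← reflPow_add]
    -- Observability is applied to `(id ∨ f)^(2ⁿ)`, whose extension lies below the target closure by
    -- induction.
    exact (hobs X _).trans (rtClosure_le_of_le_rtClosure ih)

theorem saturate_extend_saturate (hcont : lam.Continuity) (hunit : lam.Unitality)
    (hobs : lam.Observability) {X : C} (k : X ⟶ T.obj X) :
    saturate (lam.extend (saturate k)) = saturate (lam.extend k) :=
  congrArg Kleisli.Hom.of (rtClosure_klExtend_rtClosure hcont hunit hobs (toKl k))

/-- The weak behaviour map of the final coalgebra is compatible with the operations. -/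
theorem map_weakBehaviour_emAlgebra (hT : JoinsStableUnderBase T) (hcont : lam.Continuity)
    (hunit : lam.Unitality) (hobs : lam.Observability)
    {Z : Endofunctor.Coalgebra T.toFunctor} (hZ : IsTerminal Z) {g : S.obj Z.V ⟶ Z.V}
    (hg : lam.IsBialgebra g Z.str) :
    (freeMonad adj).map (weakBehaviour hZ Z.str) ≫ emAlgebra adj g ≫ weakBehaviour hZ Z.str =
      emAlgebra adj g ≫ weakBehaviour hZ Z.str := by
  have hz := weakBehaviour_hom hZ Z.str
  have h1 := hom_comp (saturate_hom hT hg.symm) hz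
  have h2 := saturate_hom hT (lam.extend_hom hz)
  rw [saturate_extend_saturate hcont hunit hobs] at h2
  exact terminal_hom_unique hZ (hom_comp h2 h1) h1

end GSOSLaw

end WeakGSOS


open WeakGSOS

theorem theorem3p9 {C : Type u} [Category.{v} C] [HasFiniteProducts C]
    (S : C ⥤ C) {F : C ⥤ Endofunctor.Algebra S} (adj : F ⊣ Endofunctor.Algebra.forget S)
    (T : Monad C) [WeakGSOS.OmegaCpoJoinEnriched (Kleisli T)]
    (hT : WeakGSOS.JoinsStableUnderBase T)
    (lam : WeakGSOS.GSOSLaw adj T.toFunctor)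
    (hcont : lam.Continuity) (hunit : lam.Unitality) (hobs : lam.Observability)
    (A : Endofunctor.Algebra S) (hA : IsInitial A)
    (Z : Endofunctor.Coalgebra T.toFunctor) (hZ : IsTerminal Z)
    (h : A.a ⟶ T.obj A.a) (hh : lam.IsBialgebra A.str h)
    (g : S.obj Z.V ⟶ Z.V) (hg : lam.IsBialgebra g Z.str) :
    A.str ≫ WeakGSOS.weakBehaviour hZ h =
      S.map (WeakGSOS.weakBehaviour hZ h) ≫ (g ≫ WeakGSOS.weakBehaviour hZ Z.str) := by
  obtain ⟨u, hu⟩ : ∃ u : A.a ⟶ Z.V, h ≫ T.map u = u ≫ Z.str :=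
    ⟨(hZ.from (Endofunctor.Coalgebra.mk A.a h)).f, (hZ.from (Endofunctor.Coalgebra.mk A.a h)).h⟩
  have hw : weakBehaviour hZ h = u ≫ weakBehaviour hZ Z.str :=
    terminal_hom_unique hZ (weakBehaviour_hom hZ h)
      (hom_comp (saturate_hom hT hu) (weakBehaviour_hom hZ Z.str))
  -- Both sides are homomorphisms from `lam.extend h` to `z`.
  have halg : emAlgebra adj A.str ≫ u = (freeMonad adj).map u ≫ emAlgebra adj g :=
    terminal_hom_unique hZ (hom_comp hh.symm hu) (hom_comp (lam.extend_hom hu) hg.symm)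
  have halg' : A.str ≫ u = S.map u ≫ g := by
    have := congrArg (opInclusion adj A.a ≫ ·) halg
    simpa only [← Category.assoc, opInclusion_emAlgebra, opInclusion_naturality,
      Category.assoc (S.map u)] using this
  have hcong : S.map (weakBehaviour hZ Z.str) ≫ g ≫ weakBehaviour hZ Z.str =
      g ≫ weakBehaviour hZ Z.str := by
    have := congrArg (opInclusion adj Z.V ≫ ·)
      (GSOSLaw.map_weakBehaviour_emAlgebra hT hcont hunit hobs hZ hg)
    simp only [← Category.assoc, opInclusion_emAlgebra, opInclusion_naturality] at this
    simpa only [Category.assoc, reassoc_of% opInclusion_emAlgebra adj g] using this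
  rw [hw, reassoc_of% halg', S.map_comp, Category.assoc, hcong]
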